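/- **Proposition (Logarithm law for contiguous systems).** Let $V$ be a finite set of spins-$\tfrac12$ and let $H=\sum_{\{a,b\}\subset V}h_{a,b}$ be a two-local Hamiltonian on $(\mathbb C^2)^{\otimes V}$ whose terms $h_{a,b}$ are Hermitian with lowest eigenvalue $0$. The interaction graph $G$ of $H$ has vertex set $V$ and an edge $\{a,b\}$ whenever $h_{a,b}\neq 0$. Assume that $H$ is *natural*, i.e. $G$ is connected and for each edge $\{a,b\}$ of $G$ there is an entangled (non-product) vector in $\mathbb C^2\otimes\mathbb C^2$ orthogonal to $\ker h_{a,b}$, and that $H$ is *unfrustrated*, i.e. $h_{a,b}|\Phi\rangle=0$ for every $\{a,b\}$ and every $|\Phi\rangle$ in the eigenspace $M$ of the lowest eigenvalue of $H$. Let $\rho$ be the maximally mixed state on $M$. For $A\subset V$ let $\partial A$ be the set of edges of $G$ between $A$ and $V\setminus A$, and call $A$ *contiguous* if any two spins of $A$ are joined by a path of $G$ inside $A$. Let $E_F(\rho)$ be the entanglement of formation of $\rho$ with respect to $A$ and $V\setminus A$, i.e. the infimum of $\sum_i p_i\,S(\mathrm{tr}_{V\setminus A}|\psi_i\rangle\langle\psi_i|)$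 over all decompositions $\rho=\sum_i p_i|\psi_i\rangle\langle\psi_i|$ into finitely many pure states, where $S$ is the von Neumann entropy; all logarithms are to base $2$. (1) For all $c,K>0$ there is a constant $C>0$, depending only on $c$ and $K$, with the following property. Let $H$ be as above, and suppose that its lattice satisfies $|\partial A|\ge K\min(|A|,|V\setminus A|)^c$ for every contiguous $A\subset V$. Then for every contiguous $A\subset V$ $$E_F(\rho)\le C\log|\partial A|\quad\text{if } |\partial A|\ge 2,\qquad\text{and in all cases}\quad E_F(\rho)\le C\log(|\partial A|+1).$$ (2) In particular, for each $d\ge 2$ there is a constant $C>0$ such that both bounds hold for every $n$, every $H$ as above whose interaction graph is the cubic lattice $\{1,\dots,n\}^d$ with nearest-neighbor edges, and every contiguous $A$. -/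

import Mathlib

open scoped Matrix ComplexOrder

noncomputable section

namespace SpinLattice

/-- The space `(ℂ²)^{⊗ V}` of pure states of a finite set `V` of spins-1/2, in the standard basis
indexed by the configurations `V → Fin 2`. -/
abbrev StateSpace (V : Type*) [Fintype V] [DecidableEq V] : Type _ :=
  EuclideanSpace ℂ (V → Fin 2)

/-- The operator on all the spins that acts as `h` on the (ordered) pair of distinct spins `(a, b)`
and as the identity on the other spins. -/
def embed {V : Type*} [Fintype V] [DecidableEq V] (a b : V)
    (h : Matrix (Fin 2 × Fin 2) (Fin 2 × Fin 2) ℂ) : Matrix (V → Fin 2) (V → Fin 2) ℂ :=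
  fun x y => if ∀ v, v ≠ a → v ≠ b → x v = y v then h (x a, x b) (y a, y b) else 0

/-- A two-spin vector is entangled if it is not a product vector. -/
def IsEntangled (β : Fin 2 × Fin 2 → ℂ) : Prop :=
  ¬ ∃ f g : Fin 2 → ℂ, ∀ i j, β (i, j) = f i * g j

/-- A two-local Hamiltonian on the spins `V`, given by its list of two-spin terms, each of which
has ground energy zero. `term a b` and `term b a` are the same term of the pair `{a, b}`, written
for the two orders of its spins; pairs that do not interact have the term `0`. -/
structure Hamiltonian (V : Type*) [Fintype V] [DecidableEq V] where
  /-- the term of the pair `{a, b}` -/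
  term : V → V → Matrix (Fin 2 × Fin 2) (Fin 2 × Fin 2) ℂ
  term_self : ∀ a, term a a = 0
  term_symm : ∀ a b, term b a = (term a b).submatrix Prod.swap Prod.swap
  posSemidef : ∀ a b, (term a b).PosSemidef
  ground_energy_zero : ∀ a b, ∃ φ : Fin 2 × Fin 2 → ℂ, φ ≠ 0 ∧ term a b *ᵥ φ = 0

/-- `∂A`: the edges of `G` between `A` and its complement. -/
def edgeBoundary {V : Type*} (G : SimpleGraph V) (A : Finset V) : Set (Sym2 V) :=
  {e | ∃ a ∈ A, ∃ b ∉ A, G.Adj a b ∧ e = s(a, b)}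

/-- `|∂A|`. -/
def boundaryArea {V : Type*} (G : SimpleGraph V) (A : Finset V) : ℕ :=
  (edgeBoundary G A).ncard

/-- Any two spins of `A` are joined by a path in `A`. -/
def IsContiguous {V : Type*} (G : SimpleGraph V) (A : Finset V) : Prop :=
  (G.induce (A : Set V)).Preconnected

/-- The lattice constants: the boundary of a contiguous region grows at least like `K` times the
`c`-th power of its size. As `V` is finite, the size of a region is measured by the smaller of the
region and its complement. -/
def HasBoundaryGrowth {V : Type*} [Fintype V] [DecidableEq V] (G : SimpleGraph V) (c K : ℝ) :
    Prop :=
  ∀ A : Finset V, IsContiguous G A →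
    K * ((min A.card Aᶜ.card : ℕ) : ℝ) ^ c ≤ (boundaryArea G A : ℝ)

/-- The cubic lattice of side `n` in dimension `d`, with open boundary: the neighbors of a site are
the sites at `ℓ¹`-distance one. -/
def cubicLattice (d n : ℕ) : SimpleGraph (Fin d → Fin n) where
  Adj x y := ∑ i, Nat.dist (x i) (y i) = 1
  symm := ⟨fun x y h => by simpa [Nat.dist_comm] using h⟩
  loopless := ⟨fun x h => by simp at h⟩

namespace Hamiltonian

variable {V : Type*} [Fintype V] [DecidableEq V] (H : Hamiltonian V)

/-- The graph of the pairs of spins with a non-zero term. -/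
def interactionGraph : SimpleGraph V where
  Adj a b := H.term a b ≠ 0
  symm := ⟨fun a b h h' => h (by rw [H.term_symm b a, h']; rfl)⟩
  loopless := ⟨fun a h => h (H.term_self a)⟩

/-- The term of the pair `{a, b}` as an operator on all the spins. -/
def termOp (a b : V) : Matrix (V → Fin 2) (V → Fin 2) ℂ := embed a b (H.term a b)

/-- The Hamiltonian as an operator: the sum of its terms over unordered pairs of spins. (The sum
over ordered pairs counts each term twice.) -/
def op : Matrix (V → Fin 2) (V → Fin 2) ℂ := (1 / 2 : ℂ) • ∑ a, ∑ b, H.termOp a b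

/-- The lowest eigenvalue of the Hamiltonian. -/
def groundEnergy : ℝ :=
  sInf {E : ℝ | Module.End.HasEigenvalue (Matrix.toEuclideanLin H.op) (E : ℂ)}

/-- The ground state manifold. -/
def groundSpace : Submodule ℂ (StateSpace V) :=
  Module.End.eigenspace (Matrix.toEuclideanLin H.op) (H.groundEnergy : ℂ)

/-- Every ground state vector is a ground state (of energy zero) of each of the terms. -/
def IsUnfrustrated : Prop :=
  ∀ ψ ∈ H.groundSpace, ∀ a b, Matrix.toEuclideanLin (H.termOp a b) ψ = 0

/-- There are no isolated subsystems, and each interaction term has an entangled excited state,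
i.e. there is an entangled vector orthogonal to the ground space of the term. -/
def IsNatural : Prop :=
  H.interactionGraph.Connected ∧
    ∀ a b, H.interactionGraph.Adj a b →
      ∃ β : Fin 2 × Fin 2 → ℂ, IsEntangled β ∧
        ∀ φ : Fin 2 × Fin 2 → ℂ, H.term a b *ᵥ φ = 0 → star β ⬝ᵥ φ = 0

/-- The ground state: the maximally mixed state over the ground state manifold. -/
def groundState : Matrix (V → Fin 2) (V → Fin 2) ℂ :=
  ((Module.finrank ℂ H.groundSpace : ℂ)⁻¹) •
    Matrix.toEuclideanLin.symm (H.groundSpace.starProjection : StateSpace V →ₗ[ℂ] StateSpace V)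

end Hamiltonian

section Entanglement

variable {V : Type*} [Fintype V] [DecidableEq V]

/-- The coefficients of a state vector, as a matrix whose rows are indexed by the configurations
of `A` and whose columns are indexed by the configurations of the complement of `A`. -/
def coeffMatrix (A : Finset V) (ψ : StateSpace V) :
    Matrix ({v // v ∈ A} → Fin 2) ({v // v ∉ A} → Fin 2) ℂ :=
  fun x y => ψ ((Equiv.piEquivPiSubtypeProd (· ∈ A) (fun _ => Fin 2)).symm (x, y))

/-- The reduced density matrix on `A` of a state vector: the partial trace of `|ψ⟩⟨ψ|` over the
complement of `A`. -/
def reducedDensity (A : Finset V) (ψ : StateSpace V) :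
    Matrix ({v // v ∈ A} → Fin 2) ({v // v ∈ A} → Fin 2) ℂ :=
  coeffMatrix A ψ * (coeffMatrix A ψ)ᴴ

theorem reducedDensity_isHermitian (A : Finset V) (ψ : StateSpace V) :
    (reducedDensity A ψ).IsHermitian :=
  Matrix.isHermitian_mul_conjTranspose_self _

/-- The entanglement entropy of a pure state with respect to `A` and its complement, in e-bits:
the von Neumann entropy `- tr ρ_A log₂ ρ_A` of the reduced state. -/
def entanglementEntropy (A : Finset V) (ψ : StateSpace V) : ℝ :=
  -∑ i, (reducedDensity_isHermitian A ψ).eigenvalues i *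
    Real.logb 2 ((reducedDensity_isHermitian A ψ).eigenvalues i)

/-- The entanglement of formation of a density matrix with respect to `A` and its complement: the
infimum, over all finite decompositions into pure states, of the mean entanglement entropy. -/
def entanglementOfFormation (A : Finset V) (ρ : Matrix (V → Fin 2) (V → Fin 2) ℂ) : ℝ :=
  sInf {E : ℝ | ∃ (m : ℕ) (p : Fin m → ℝ) (ψ : Fin m → StateSpace V),
    (∀ i, 0 ≤ p i) ∧ ∑ i, p i = 1 ∧ (∀ i, ‖ψ i‖ = 1) ∧
    ρ = ∑ i, (p i : ℂ) • Matrix.vecMulVec (ψ i) (star (ψ i : (V → Fin 2) → ℂ)) ∧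
    E = ∑ i, p i * entanglementEntropy A (ψ i)}

end Entanglement

end SpinLattice

end

/-!
Root a spanning tree of the interaction graph and choose, from the root outwards, invertible
one-spin operators that carry the ground space of each tree edge into the orthogonal complement of
the singlet. They turn every ground state into a vector that is symmetric under the
transpositions of the tree edges, hence under all permutations of the spins. Its amplitudes depend
only on the number of up spins, which is the sum of the numbers of up spins in `A` and outside `A`,
so its Schmidt rank across `A` is at most `min(|A|, |V∖A|) + 1`. Invertible one-spin operators do
not change the Schmidt rank, and the entropy is at most the logarithm of the Schmidt rank, so every
ground state has entropy at most `log (min(|A|, |V∖A|) + 1)`; the growth of the boundary bounds the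
minimum by a power of `|∂A|`.

In the cubic lattice, a grid line through a point of `A` either lies in `A` or contains a point of
`A` at its boundary. Giving each point of `A` the weight `1/n`, and one more at the boundary, makes
the total weight of each such line at least one, and the discrete Loomis–Whitney inequality bounds
`|A| ^ (1 - 1/d)` by the total weight, at most `|∂A| + |A|/n`. When `A` is at most half of the
lattice, the term `|A|/n` is only a fraction of the left-hand side.
-/

open scoped Matrix ComplexOrder

noncomputable section

namespace SpinLattice

section LocalOperators

/-- The configuration `x` with the values at `a` and `b` changed to `p.1` and `p.2`; a pair of sites
of a configuration is read through this function wherever a two-spin operator acts. -/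
def setPair {V α : Type*} [DecidableEq V] (x : V → α) (a b : V) (p : α × α) : V → α :=
  Function.update (Function.update x a p.1) b p.2

/-- The tensor product `⨂ v, M v` of one-site operators, which acts on configurations. -/
def localOp {ι α R : Type*} [Fintype ι] [CommSemiring R] (M : ι → Matrix α α R) :
    Matrix (ι → α) (ι → α) R :=
  fun x y => ∏ v, M v (x v) (y v)

/-- The coefficients of the (unnormalized) singlet of two spins, as a matrix. -/
def singlet : Matrix (Fin 2) (Fin 2) ℂ := !![0, 1; -1, 0]

section SetPair

variable {V α : Type*} [DecidableEq V] {a b : V}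

theorem setPair_left (hab : a ≠ b) (x : V → α) (p : α × α) : setPair x a b p a = p.1 := by
  simp [setPair, hab]

theorem setPair_right (a b : V) (x : V → α) (p : α × α) : setPair x a b p b = p.2 := by
  simp [setPair]

theorem setPair_of_ne {v : V} (ha : v ≠ a) (hb : v ≠ b) (x : V → α) (p : α × α) :
    setPair x a b p v = x v := by
  simp [setPair, ha, hb]

theorem eq_setPair_iff (hab : a ≠ b) {x y : V → α} {p : α × α} :
    y = setPair x a b p ↔ y a = p.1 ∧ y b = p.2 ∧ ∀ v, v ≠ a → v ≠ b → x v = y v := by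
  constructor
  · rintro rfl
    exact ⟨setPair_left hab x p, setPair_right a b x p,
      fun v ha hb => (setPair_of_ne ha hb x p).symm⟩
  · rintro ⟨ha, hb, hoff⟩
    ext v
    by_cases hvb : v = b
    · rw [hvb, hb, setPair_right]
    by_cases hva : v = a
    · rw [hva, ha, setPair_left hab]
    · rw [setPair_of_ne hva hvb, hoff v hva hvb]

theorem setPair_setPair (hab : a ≠ b) (x : V → α) (p q : α × α) :
    setPair (setPair x a b p) a b q = setPair x a b q := by
  rw [eq_setPair_iff hab]
  exact ⟨setPair_left hab _ q, setPair_right a b _ q, fun v ha hb => by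
    rw [setPair_of_ne ha hb, setPair_of_ne ha hb]⟩

theorem setPair_self (hab : a ≠ b) (x : V → α) : setPair x a b (x a, x b) = x :=
  ((eq_setPair_iff hab).2 ⟨rfl, rfl, fun _ _ _ => rfl⟩).symm

theorem comp_swap_eq_setPair (hab : a ≠ b) (x : V → α) :
    x ∘ Equiv.swap a b = setPair x a b (x b, x a) :=
  (eq_setPair_iff hab).2 ⟨by simp, by simp, fun v ha hb => by
    simp [Equiv.swap_apply_of_ne_of_ne ha hb]⟩

variable [Fintype V] [Fintype α] {M : Type*} [AddCommMonoid M]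

theorem sum_ite_eq_off_pair [DecidableEq α] (hab : a ≠ b) (x : V → α) (F : (V → α) → M) :
    ∑ y, (if ∀ v, v ≠ a → v ≠ b → x v = y v then F y else 0) =
      ∑ p : α × α, F (setPair x a b p) := by
  rw [← Finset.sum_filter]
  refine (Finset.sum_nbij' (fun p => setPair x a b p) (fun y => (y a, y b)) ?_ ?_ ?_ ?_ ?_).symm
  · exact fun p _ => Finset.mem_filter.2 ⟨Finset.mem_univ _, ((eq_setPair_iff hab).1 rfl).2.2⟩
  · simp
  · exact fun p _ => by simp [setPair_left hab, setPair_right]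
  · exact fun y hy => ((eq_setPair_iff hab).2 ⟨rfl, rfl, (Finset.mem_filter.1 hy).2⟩).symm
  · simp

theorem sum_sum_setPair (hab : a ≠ b) (F : (V → α) → M) :
    ∑ x, ∑ p : α × α, F (setPair x a b p) = Fintype.card (α × α) • ∑ y, F y := by
  classical
  simp only [← sum_ite_eq_off_pair hab]
  rw [Finset.sum_comm, Finset.smul_sum]
  refine Finset.sum_congr rfl fun y _ => ?_
  simp_rw [eq_comm (b := y _)]
  rw [sum_ite_eq_off_pair hab y fun _ => F y, Finset.sum_const, Finset.card_univ]

theorem embed_mulVec_setPair (hab : a ≠ b) (h : Matrix (Fin 2 × Fin 2) (Fin 2 × Fin 2) ℂ)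
    (ψ : (V → Fin 2) → ℂ) (x : V → Fin 2) (p : Fin 2 × Fin 2) :
    (embed a b h *ᵥ ψ) (setPair x a b p) = (h *ᵥ fun q => ψ (setPair x a b q)) p := by
  have hsum := sum_ite_eq_off_pair hab (setPair x a b p) fun y => h p (y a, y b) * ψ y
  simp only [setPair_setPair hab, setPair_left hab, setPair_right] at hsum
  simpa only [Matrix.mulVec, dotProduct, embed, setPair_left hab, setPair_right, ite_mul,
    zero_mul] using hsum

end SetPair

section LocalOp

variable {ι α R : Type*} [Fintype ι] [CommSemiring R]

theorem localOp_mul [DecidableEq ι] [Fintype α] (M N : ι → Matrix α α R) :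
    localOp M * localOp N = localOp fun v => M v * N v := by
  ext x y
  simp only [localOp, Matrix.mul_apply, Finset.prod_univ_sum, Fintype.piFinset_univ,
    Finset.prod_mul_distrib]

theorem localOp_one [DecidableEq α] : localOp (fun _ : ι => (1 : Matrix α α R)) = 1 := by
  ext x y
  simp only [localOp, Matrix.one_apply, Finset.prod_ite_zero, Finset.prod_const_one,
    Finset.mem_univ, true_imp_iff, funext_iff]

theorem localOp_setPair [DecidableEq ι] {a b : ι} (hab : a ≠ b) (M : ι → Matrix α α R)
    (x y : ι → α) (p : α × α) :
    localOp M (setPair x a b p) y =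
      M a p.1 (y a) * M b p.2 (y b) * ∏ v ∈ ({a, b} : Finset ι)ᶜ, M v (x v) (y v) := by
  rw [localOp, ← Finset.prod_mul_prod_compl {a, b}, Finset.prod_pair hab, setPair_left hab,
    setPair_right]
  congr 1
  refine Finset.prod_congr rfl fun v hv => ?_
  simp only [Finset.mem_compl, Finset.mem_insert, Finset.mem_singleton, not_or] at hv
  rw [setPair_of_ne hv.1 hv.2]

end LocalOp

variable {V : Type*} [Fintype V] [DecidableEq V] {a b : V} {M : V → Matrix (Fin 2) (Fin 2) ℂ}
  {ψ : (V → Fin 2) → ℂ}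

theorem localOp_mulVec_setPair_comm (hab : a ≠ b)
    (hψ : ∀ x, ∑ p : Fin 2 × Fin 2,
      ((M a)ᵀ * singlet * M b) p.1 p.2 * ψ (setPair x a b p) = 0) (x : V → Fin 2) :
    (localOp M *ᵥ ψ) (setPair x a b (0, 1)) = (localOp M *ᵥ ψ) (setPair x a b (1, 0)) := by
  set rest : (V → Fin 2) → ℂ := fun y => ∏ v ∈ ({a, b} : Finset V)ᶜ, M v (x v) (y v)
  have hrest : ∀ z p, rest (setPair z a b p) = rest z := fun z p =>
    Finset.prod_congr rfl fun v hv => by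
      simp only [Finset.mem_compl, Finset.mem_insert, Finset.mem_singleton, not_or] at hv
      rw [setPair_of_ne hv.1 hv.2]
  have hdiff : (localOp M *ᵥ ψ) (setPair x a b (0, 1)) - (localOp M *ᵥ ψ) (setPair x a b (1, 0)) =
      ∑ y, rest y * (((M a)ᵀ * singlet * M b) (y a) (y b) * ψ y) := by
    simp only [Matrix.mulVec, dotProduct, localOp_setPair hab, ← Finset.sum_sub_distrib]
    refine Finset.sum_congr rfl fun y _ => ?_
    simp only [rest, singlet, Matrix.mul_apply, Matrix.transpose_apply, Fin.sum_univ_two,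
      Matrix.of_apply, Matrix.cons_val', Matrix.cons_val_zero, Matrix.cons_val_one,
      Matrix.cons_val_fin_one]
    ring
  have hpairs := sum_sum_setPair hab fun y =>
    rest y * (((M a)ᵀ * singlet * M b) (y a) (y b) * ψ y)
  simp only [hrest, setPair_left hab, setPair_right, ← Finset.mul_sum, hψ, mul_zero,
    Finset.sum_const_zero] at hpairs
  rw [← sub_eq_zero, hdiff]
  simpa using hpairs.symm

/-- By `hψ`, the vector `localOp M *ᵥ ψ` is orthogonal to the singlet of `a` and `b`, and the
two-spin vectors orthogonal to the singlet are the symmetric ones. -/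
theorem localOp_mulVec_comp_swap (hab : a ≠ b)
    (hψ : ∀ x, ∑ p : Fin 2 × Fin 2,
      ((M a)ᵀ * singlet * M b) p.1 p.2 * ψ (setPair x a b p) = 0) (x : V → Fin 2) :
    (localOp M *ᵥ ψ) (x ∘ Equiv.swap a b) = (localOp M *ᵥ ψ) x := by
  have hcomm := localOp_mulVec_setPair_comm hab hψ x
  have hself := setPair_self hab x
  rw [comp_swap_eq_setPair hab]
  conv_rhs => rw [← hself]
  generalize x a = i, x b = j
  fin_cases i <;> fin_cases j
  · rfl
  · exact hcomm.symm
  · exact hcomm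
  · rfl

theorem exists_isUnit_transpose_mul_singlet_mul_eq {N B : Matrix (Fin 2) (Fin 2) ℂ}
    (hN : IsUnit N) (hB : IsUnit B) :
    ∃ N' : Matrix (Fin 2) (Fin 2) ℂ, IsUnit N' ∧ Nᵀ * singlet * N' = B := by
  have hsinglet : IsUnit singlet := by simp [Matrix.isUnit_iff_isUnit_det, singlet]
  obtain ⟨E, hE⟩ := ((Matrix.isUnit_transpose N).2 hN).mul hsinglet
  exact ⟨E⁻¹.val * B, E⁻¹.isUnit.mul hB, by rw [← hE, Units.mul_inv_cancel_left]⟩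

theorem IsEntangled.isUnit_of_star {β : Fin 2 × Fin 2 → ℂ} (h : IsEntangled β) :
    IsUnit (Matrix.of fun i j => star (β (i, j))) := by
  rw [Matrix.isUnit_iff_isUnit_det, isUnit_iff_ne_zero]
  intro hdet
  obtain ⟨v, hv, hker⟩ := Matrix.exists_mulVec_eq_zero_iff.2 hdet
  have hrow : ∀ i, β (i, 0) * star (v 0) + β (i, 1) * star (v 1) = 0 := fun i => by
    simpa [Matrix.mulVec, dotProduct, Fin.sum_univ_two] using congrArg star (congrFun hker i)
  apply h
  by_cases hv0 : v 0 = 0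
  · have hv1 : v 1 ≠ 0 := fun hv1 => hv (by ext i; fin_cases i <;> simp [hv0, hv1])
    refine ⟨fun i => β (i, 0), ![1, 0], fun i j => ?_⟩
    fin_cases j
    · simp
    · simpa [hv0, hv1] using hrow i
  · refine ⟨fun i => β (i, 1), ![-star (v 1) / star (v 0), 1], fun i j => ?_⟩
    have hstar : star (v 0) ≠ 0 := star_ne_zero.2 hv0
    fin_cases j
    · simp only [Fin.zero_eta, Matrix.cons_val_zero]
      field_simp
      linear_combination hrow i
    · simp

end LocalOperators

section Permutations

theorem exists_forall_rel_parent {α β : Type*} [Nonempty β] {lt : α → α → Prop}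
    (hwf : WellFounded lt) {root : α} {parent : α → α}
    (hparent : ∀ v, v ≠ root → lt (parent v) v) {R : α → β → β → Prop}
    (hR : ∀ v, v ≠ root → ∀ N, ∃ N', R v N N') :
    ∃ M : α → β, ∀ v, v ≠ root → R v (M (parent v)) (M v) := by
  classical
  choose! step hstep using hR
  let M : α → β := hwf.fix fun v ih =>
    if h : v = root then Classical.arbitrary β else step v (ih (parent v) (hparent v h))
  refine ⟨M, fun v hv => ?_⟩
  have hM : M v = step v (M (parent v)) := by
    simp only [M]
    rw [WellFounded.fix_eq, dif_neg hv]
  rw [hM]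
  exact hstep v hv _

theorem exists_adj_dist_lt {V : Type*} {G : SimpleGraph V} (hG : G.Connected) {r v : V}
    (hv : v ≠ r) : ∃ u, G.Adj u v ∧ G.dist r u < G.dist r v := by
  obtain ⟨p, hp⟩ := hG.exists_walk_length_eq_dist v r
  cases p with
  | nil => exact absurd rfl hv
  | @cons _ u _ h q =>
    refine ⟨u, h.symm, ?_⟩
    rw [SimpleGraph.dist_comm, G.dist_comm (u := r), ← hp, SimpleGraph.Walk.length_cons]
    exact Nat.lt_succ_of_le (SimpleGraph.dist_le q)

theorem subgroup_eq_top_of_swap_parent_mem {V : Type*} [Finite V] [DecidableEq V]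
    {lt : V → V → Prop} (hwf : WellFounded lt) {root : V} {parent : V → V}
    (hparent : ∀ v, v ≠ root → lt (parent v) v) (S : Subgroup (Equiv.Perm V))
    (hS : ∀ v, v ≠ root → Equiv.swap (parent v) v ∈ S) : S = ⊤ := by
  have hroot : ∀ v, Equiv.swap root v ∈ S := fun v => by
    induction v using hwf.induction with
    | _ v ih =>
      by_cases hv : v = root
      · rw [hv, Equiv.swap_self]
        exact S.one_mem
      · exact SubmonoidClass.swap_mem_trans S (ih _ (hparent v hv)) (hS v hv)
  rw [← top_le_iff, ← Equiv.Perm.closure_isSwap, Subgroup.closure_le]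
  rintro _ ⟨a, b, -, rfl⟩
  exact SubmonoidClass.swap_mem_trans S (Equiv.swap_comm a root ▸ hroot a) (hroot b)

/-- The group of the permutations of the sites under which a function of configurations is
invariant. -/
def permInvariance {V α β : Type*} (φ : (V → α) → β) : Subgroup (Equiv.Perm V) where
  carrier := {σ | ∀ x, φ (x ∘ σ) = φ x}
  one_mem' _ := rfl
  mul_mem' {σ τ} hσ hτ x := by
    rw [Equiv.Perm.coe_mul, ← Function.comp_assoc, hτ, hσ]
  inv_mem' {σ} hσ x := by
    rw [← hσ, Function.comp_assoc, ← Equiv.Perm.coe_mul, inv_mul_cancel, Equiv.Perm.coe_one,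
      Function.comp_id]

/-- The number of spins that are up. -/
def weight {ι : Type*} [Fintype ι] (x : ι → Fin 2) : ℕ := ∑ v, (x v : ℕ)

theorem weight_eq_card {ι : Type*} [Fintype ι] (x : ι → Fin 2) :
    weight x = Fintype.card {v // x v = 1} := by
  rw [Fintype.card_subtype, Finset.card_filter]
  refine Finset.sum_congr rfl fun v _ => ?_
  generalize x v = i
  fin_cases i <;> rfl

theorem exists_perm_of_weight_eq {V : Type*} [Fintype V] {x y : V → Fin 2}
    (h : weight x = weight y) : ∃ σ : Equiv.Perm V, y ∘ σ = x := by
  have hup : Fintype.card {v // x v = 1} = Fintype.card {v // y v = 1} := by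
    rwa [← weight_eq_card, ← weight_eq_card]
  have hdown : Fintype.card {v // x v = 0} = Fintype.card {v // y v = 0} := by
    have hzero : ∀ i : Fin 2, i = 0 ↔ ¬i = 1 := by decide
    simpa only [hzero] using Fintype.card_compl_eq_card_compl _ _ hup
  have hfiber : ∀ i, Nonempty ({v // x v = i} ≃ {v // y v = i}) :=
    Fin.forall_fin_two.2 ⟨Fintype.card_eq.1 hdown, Fintype.card_eq.1 hup⟩
  exact ⟨Equiv.ofFiberEquiv fun i => (hfiber i).some, funext fun v => Equiv.ofFiberEquiv_map _ v⟩

theorem factorsThrough_weight_of_permInvariance_eq_top {V β : Type*} [Fintype V]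
    {φ : (V → Fin 2) → β} (h : permInvariance φ = ⊤) : Function.FactorsThrough φ weight := by
  intro x y hxy
  obtain ⟨σ, rfl⟩ := exists_perm_of_weight_eq hxy
  exact (h ▸ Subgroup.mem_top σ : σ ∈ permInvariance φ) y

end Permutations

section GroundSpace

variable {V : Type*} [Fintype V] [DecidableEq V] {H : Hamiltonian V}

theorem Hamiltonian.IsUnfrustrated.term_mulVec_setPair_eq_zero (hU : H.IsUnfrustrated) {a b : V}
    (hab : a ≠ b) {ψ : StateSpace V} (hψ : ψ ∈ H.groundSpace) (x : V → Fin 2) :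
    H.term a b *ᵥ (fun p => ψ (setPair x a b p)) = 0 := by
  have hterm : H.termOp a b *ᵥ ψ = 0 := congrArg WithLp.ofLp (hU ψ hψ a b)
  ext p
  rw [← embed_mulVec_setPair hab]
  exact congrFun hterm (setPair x a b p)

/-- The last condition says that `M (parent v) ⊗ M v` maps the ground space of the term of the edge
`{parent v, v}` into the orthogonal complement of the singlet. -/
theorem Hamiltonian.IsNatural.exists_frame (hN : H.IsNatural) :
    ∃ (r : V) (parent : V → V) (M : V → Matrix (Fin 2) (Fin 2) ℂ), (∀ v, IsUnit (M v)) ∧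
      ∀ v, v ≠ r → H.interactionGraph.dist r (parent v) < H.interactionGraph.dist r v ∧
        parent v ≠ v ∧ ∀ φ : Fin 2 × Fin 2 → ℂ, H.term (parent v) v *ᵥ φ = 0 →
          ∑ p, ((M (parent v))ᵀ * singlet * M v) p.1 p.2 * φ p = 0 := by
  obtain ⟨hG, hE⟩ := hN
  obtain ⟨r⟩ := hG.nonempty
  choose! β hent horth using hE
  choose! parent hadj hdist using fun v (hv : v ≠ r) => exists_adj_dist_lt hG hv
  obtain ⟨M, hM⟩ := exists_forall_rel_parent (β := (Matrix (Fin 2) (Fin 2) ℂ)ˣ)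
    (R := fun v N N' => N.valᵀ * singlet * N'.val =
      Matrix.of fun i j => star (β (parent v) v (i, j)))
    (measure (H.interactionGraph.dist r)).wf hdist fun v hv N => by
      obtain ⟨N', hN', heq⟩ := exists_isUnit_transpose_mul_singlet_mul_eq N.isUnit
        (hent _ _ (hadj v hv)).isUnit_of_star
      exact ⟨hN'.unit, heq⟩
  refine ⟨r, parent, fun v => (M v).val, fun v => (M v).isUnit, fun v hv =>
    ⟨hdist v hv, (hadj v hv).ne, fun φ hφ => ?_⟩⟩
  rw [hM v hv]
  exact horth _ _ (hadj v hv) φ hφ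

theorem Hamiltonian.exists_permInvariance_localOp_mulVec_eq_top (hN : H.IsNatural)
    (hU : H.IsUnfrustrated) :
    ∃ M : V → Matrix (Fin 2) (Fin 2) ℂ, (∀ v, IsUnit (M v)) ∧
      ∀ ψ ∈ H.groundSpace, permInvariance (localOp M *ᵥ ψ) = ⊤ := by
  obtain ⟨r, parent, M, hM, htree⟩ := hN.exists_frame
  refine ⟨M, hM, fun ψ hψ => subgroup_eq_top_of_swap_parent_mem
    (measure (H.interactionGraph.dist r)).wf (fun v hv => (htree v hv).1) _ fun v hv x => ?_⟩
  obtain ⟨-, hne, horth⟩ := htree v hv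
  exact localOp_mulVec_comp_swap hne
    (fun y => horth _ (hU.term_mulVec_setPair_eq_zero hne hψ y)) x

theorem Hamiltonian.exists_eq_localOp_mulVec_weight (hN : H.IsNatural) (hU : H.IsUnfrustrated) :
    ∃ N : V → Matrix (Fin 2) (Fin 2) ℂ, ∀ ψ ∈ H.groundSpace, ∃ F : ℕ → ℂ,
      (ψ : (V → Fin 2) → ℂ) = localOp N *ᵥ fun x => F (weight x) := by
  obtain ⟨M, hM, hinv⟩ := H.exists_permInvariance_localOp_mulVec_eq_top hN hU
  refine ⟨fun v => (M v)⁻¹, fun ψ hψ => ?_⟩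
  set φ : (V → Fin 2) → ℂ := localOp M *ᵥ ψ with hφ
  have hfactors := factorsThrough_weight_of_permInvariance_eq_top (hinv ψ hψ)
  have hleft : localOp (fun v => (M v)⁻¹) * localOp M = 1 := by
    rw [localOp_mul, ← localOp_one]
    exact congrArg localOp
      (funext fun v => Matrix.nonsing_inv_mul _ ((Matrix.isUnit_iff_isUnit_det _).1 (hM v)))
  have hweight : (fun x : V → Fin 2 => Function.extend weight φ 0 (weight x)) = φ :=
    funext (hfactors.extend_apply 0)
  exact ⟨Function.extend weight φ 0, by
    rw [hweight, hφ, Matrix.mulVec_mulVec, hleft, Matrix.one_mulVec]⟩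

end GroundSpace

section SchmidtRank

theorem weight_le_card {ι : Type*} [Fintype ι] (x : ι → Fin 2) : weight x ≤ Fintype.card ι := by
  rw [weight_eq_card]
  exact Fintype.card_subtype_le _

theorem rank_of_weight_add_weight_le {ι κ : Type*} [Fintype ι] [Fintype κ] [DecidableEq κ]
    (F : ℕ → ℂ) :
    (Matrix.of fun (x : ι → Fin 2) (y : κ → Fin 2) => F (weight x + weight y)).rank ≤
      min (Fintype.card ι) (Fintype.card κ) + 1 := by
  rw [← min_add_add_right, le_min_iff]
  constructor
  · refine (Matrix.rank_submatrix_le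
      (Matrix.of fun (k : Fin (Fintype.card ι + 1)) (y : κ → Fin 2) => F (k + weight y))
      (fun x => ⟨weight x, Nat.lt_succ_of_le (weight_le_card x)⟩) id).trans ?_
    exact (Matrix.rank_le_card_height _).trans_eq (Fintype.card_fin _)
  · refine (Matrix.rank_submatrix_le
      (Matrix.of fun (x : ι → Fin 2) (k : Fin (Fintype.card κ + 1)) => F (weight x + k)) id
      (fun y => ⟨weight y, Nat.lt_succ_of_le (weight_le_card y)⟩)).trans ?_
    exact (Matrix.rank_le_card_width _).trans_eq (Fintype.card_fin _)

variable {V : Type*} [Fintype V] [DecidableEq V] (A : Finset V)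

theorem weight_piEquivPiSubtypeProd_symm (x : {v // v ∈ A} → Fin 2) (y : {v // v ∉ A} → Fin 2) :
    weight ((Equiv.piEquivPiSubtypeProd (· ∈ A) (fun _ => Fin 2)).symm (x, y)) =
      weight x + weight y := by
  simp only [weight]
  rw [← Fintype.sum_subtype_add_sum_subtype (· ∈ A)]
  congr 1 <;> exact Finset.sum_congr (by ext; simp) fun v _ => by simp [v.2]

theorem localOp_piEquivPiSubtypeProd_symm (N : V → Matrix (Fin 2) (Fin 2) ℂ)
    (x x' : {v // v ∈ A} → Fin 2) (y y' : {v // v ∉ A} → Fin 2) :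
    localOp N ((Equiv.piEquivPiSubtypeProd (· ∈ A) (fun _ => Fin 2)).symm (x, y))
        ((Equiv.piEquivPiSubtypeProd (· ∈ A) (fun _ => Fin 2)).symm (x', y')) =
      localOp (fun v : {v // v ∈ A} => N v) x x' * localOp (fun v : {v // v ∉ A} => N v) y y' := by
  simp only [localOp]
  rw [← Fintype.prod_subtype_mul_prod_subtype (· ∈ A)]
  congr 1 <;> exact Finset.prod_congr (by ext; simp) fun v _ => by simp [v.2]

theorem coeffMatrix_localOp_mulVec (N : V → Matrix (Fin 2) (Fin 2) ℂ) (φ : StateSpace V) :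
    coeffMatrix A (WithLp.toLp 2 (localOp N *ᵥ φ)) =
      localOp (fun v : {v // v ∈ A} => N v) * coeffMatrix A φ *
        (localOp fun v : {v // v ∉ A} => N v)ᵀ := by
  ext x y
  simp only [coeffMatrix, Matrix.mulVec, dotProduct, Matrix.mul_apply, Matrix.transpose_apply]
  rw [← (Equiv.piEquivPiSubtypeProd (· ∈ A) (fun _ => Fin 2)).symm.sum_comp,
    Fintype.sum_prod_type_right]
  refine Finset.sum_congr rfl fun y' _ => ?_
  rw [Finset.sum_mul]
  refine Finset.sum_congr rfl fun x' _ => ?_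
  rw [localOp_piEquivPiSubtypeProd_symm]
  ring

theorem rank_coeffMatrix_weight_le (F : ℕ → ℂ) :
    (coeffMatrix A (WithLp.toLp 2 fun x => F (weight x))).rank ≤ min A.card Aᶜ.card + 1 := by
  have hcoeff : coeffMatrix A (WithLp.toLp 2 fun x => F (weight x)) =
      Matrix.of fun x y => F (weight x + weight y) := by
    ext x y
    simp only [coeffMatrix, weight_piEquivPiSubtypeProd_symm, Matrix.of_apply]
  have hcompl : Fintype.card {v // v ∉ A} = Aᶜ.card :=
    Fintype.card_of_subtype _ fun _ => Finset.mem_compl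
  rw [hcoeff, ← Fintype.card_coe A, ← hcompl]
  exact rank_of_weight_add_weight_le F

theorem rank_coeffMatrix_le_of_mem_groundSpace {H : Hamiltonian V} (hN : H.IsNatural)
    (hU : H.IsUnfrustrated) {ψ : StateSpace V} (hψ : ψ ∈ H.groundSpace) :
    (coeffMatrix A ψ).rank ≤ min A.card Aᶜ.card + 1 := by
  obtain ⟨N, hframe⟩ := H.exists_eq_localOp_mulVec_weight hN hU
  obtain ⟨F, hF⟩ := hframe ψ hψ
  have hψ_eq : ψ = WithLp.toLp 2
      (localOp N *ᵥ (WithLp.toLp 2 fun x => F (weight x) : StateSpace V)) := by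
    rw [← hF]
  rw [hψ_eq, coeffMatrix_localOp_mulVec]
  exact (Matrix.rank_mul_le_left _ _).trans
    ((Matrix.rank_mul_le_right _ _).trans (rank_coeffMatrix_weight_le A F))

end SchmidtRank

section Entropy

theorem sum_negMulLog_le_log_card {ι : Type*} {s : Finset ι} {p : ι → ℝ} (hp : ∀ i ∈ s, 0 ≤ p i)
    (hsum : ∑ i ∈ s, p i = 1) : ∑ i ∈ s, Real.negMulLog (p i) ≤ Real.log s.card := by
  have hs : s.Nonempty := Finset.nonempty_of_sum_ne_zero (hsum.trans_ne one_ne_zero)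
  have hcard : (0 : ℝ) < s.card := by exact_mod_cast hs.card_pos
  have hjensen : ∑ i ∈ s, (s.card : ℝ)⁻¹ • Real.negMulLog (p i) ≤
      Real.negMulLog (∑ i ∈ s, (s.card : ℝ)⁻¹ • p i) :=
    Real.concaveOn_negMulLog.le_map_sum (fun _ _ => by positivity) (by simp [hcard.ne']) hp
  rw [← Finset.smul_sum, ← Finset.smul_sum, hsum, smul_eq_mul, smul_eq_mul, mul_one,
    Real.negMulLog, Real.log_inv, neg_mul_neg] at hjensen
  exact le_of_mul_le_mul_left hjensen (inv_pos.2 hcard)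

variable {V : Type*} [Fintype V] [DecidableEq V] (A : Finset V) (ψ : StateSpace V)

theorem eigenvalues_reducedDensity_nonneg (i) :
    0 ≤ (reducedDensity_isHermitian A ψ).eigenvalues i :=
  (Matrix.posSemidef_self_mul_conjTranspose (coeffMatrix A ψ)).eigenvalues_nonneg i

theorem trace_reducedDensity : (reducedDensity A ψ).trace = (‖ψ‖ : ℂ) ^ 2 := by
  rw [← Complex.ofReal_pow, EuclideanSpace.norm_sq_eq,
    ← (Equiv.piEquivPiSubtypeProd (· ∈ A) (fun _ => Fin 2)).symm.sum_comp, Fintype.sum_prod_type]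
  simp only [Matrix.trace, Matrix.diag, reducedDensity, Matrix.mul_apply,
    Matrix.conjTranspose_apply, coeffMatrix]
  push_cast
  exact Finset.sum_congr rfl fun x _ => Finset.sum_congr rfl fun y _ => Complex.mul_conj' _

theorem sum_eigenvalues_reducedDensity :
    ∑ i, (reducedDensity_isHermitian A ψ).eigenvalues i = ‖ψ‖ ^ 2 := by
  apply Complex.ofReal_injective
  push_cast
  rw [← trace_reducedDensity A ψ]
  exact (reducedDensity_isHermitian A ψ).trace_eq_sum_eigenvalues.symm

theorem entanglementEntropy_eq_sum_negMulLog : entanglementEntropy A ψ =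
    (∑ i, Real.negMulLog ((reducedDensity_isHermitian A ψ).eigenvalues i)) / Real.log 2 := by
  simp only [entanglementEntropy, Real.negMulLog, Real.logb, neg_mul, Finset.sum_neg_distrib,
    Finset.sum_div, neg_div, mul_div_assoc]

variable {ψ}

theorem entanglementEntropy_nonneg (hψ : ‖ψ‖ = 1) : 0 ≤ entanglementEntropy A ψ := by
  have hsum : ∑ i, (reducedDensity_isHermitian A ψ).eigenvalues i = 1 := by
    rw [sum_eigenvalues_reducedDensity, hψ, one_pow]
  have hnonneg := eigenvalues_reducedDensity_nonneg A ψ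
  rw [entanglementEntropy_eq_sum_negMulLog]
  refine div_nonneg (Finset.sum_nonneg fun i _ => Real.negMulLog_nonneg (hnonneg i) ?_)
    (Real.log_nonneg one_le_two)
  exact hsum ▸ Finset.single_le_sum (fun j _ => hnonneg j) (Finset.mem_univ i)

theorem entanglementEntropy_le_logb_rank (hψ : ‖ψ‖ = 1) :
    entanglementEntropy A ψ ≤ Real.logb 2 (coeffMatrix A ψ).rank := by
  set μ := (reducedDensity_isHermitian A ψ).eigenvalues
  have hsum : ∑ i with μ i ≠ 0, μ i = 1 := by
    rw [Finset.sum_filter_ne_zero, sum_eigenvalues_reducedDensity, hψ, one_pow]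
  have hrank : (Finset.univ.filter fun i => μ i ≠ 0).card = (coeffMatrix A ψ).rank := by
    rw [← Matrix.rank_self_mul_conjTranspose, ← Fintype.card_subtype]
    exact (reducedDensity_isHermitian A ψ).rank_eq_card_non_zero_eigs.symm
  have hlog := sum_negMulLog_le_log_card
    (fun i _ => eigenvalues_reducedDensity_nonneg A ψ i) hsum
  rw [hrank, Finset.sum_filter_of_ne fun i _ => mt fun h =>
    (congrArg Real.negMulLog h).trans Real.negMulLog_zero] at hlog
  rw [entanglementEntropy_eq_sum_negMulLog, Real.logb]
  gcongr

end Entropy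

section Formation

variable {V : Type*} [Fintype V] [DecidableEq V]

theorem embed_isHermitian {a b : V} {h : Matrix (Fin 2 × Fin 2) (Fin 2 × Fin 2) ℂ}
    (hh : h.IsHermitian) : (embed a b h).IsHermitian := by
  ext x y
  simp only [Matrix.conjTranspose_apply, embed]
  by_cases hxy : ∀ v, v ≠ a → v ≠ b → x v = y v
  · rw [if_pos hxy, if_pos fun v ha hb => (hxy v ha hb).symm, hh.apply]
  · rw [if_neg hxy, if_neg fun hyx => hxy fun v ha hb => (hyx v ha hb).symm, star_zero]

theorem Hamiltonian.op_isHermitian (H : Hamiltonian V) : H.op.IsHermitian := by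
  have hsum : (∑ a, ∑ b, H.termOp a b).IsHermitian :=
    isSelfAdjoint_sum _ fun a _ => isSelfAdjoint_sum _ fun b _ =>
      embed_isHermitian (H.posSemidef a b).isHermitian
  rw [Hamiltonian.op, Matrix.IsHermitian, Matrix.conjTranspose_smul, hsum]
  simp

theorem Hamiltonian.groundSpace_ne_bot (H : Hamiltonian V) : H.groundSpace ≠ ⊥ := by
  set T := Matrix.toEuclideanLin H.op
  have hfin : {E : ℝ | Module.End.HasEigenvalue T (E : ℂ)}.Finite :=
    (Module.End.finite_hasEigenvalue T).preimage Complex.ofReal_injective.injOn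
  have hT : T.IsSymmetric := Matrix.isSymmetric_toEuclideanLin_iff.2 H.op_isHermitian
  obtain ⟨μ, hμ⟩ := Module.End.exists_eigenvalue T
  have hre : ((μ.re : ℝ) : ℂ) = μ := Complex.conj_eq_iff_re.1 (hT.conj_eigenvalue_eq_self hμ)
  have hne : {E : ℝ | Module.End.HasEigenvalue T (E : ℂ)}.Nonempty :=
    ⟨μ.re, (congrArg (Module.End.HasEigenvalue T) hre).mpr hμ⟩
  exact hne.csInf_mem hfin

theorem Hamiltonian.groundState_eq_sum (H : Hamiltonian V) {ι : Type*} [Fintype ι]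
    (b : OrthonormalBasis ι ℂ H.groundSpace) :
    H.groundState = ∑ i, (Module.finrank ℂ H.groundSpace : ℂ)⁻¹ •
      Matrix.vecMulVec (b i : StateSpace V) (star ((b i : StateSpace V) : (V → Fin 2) → ℂ)) := by
  rw [Hamiltonian.groundState, ← Finset.smul_sum]
  congr 1
  rw [LinearEquiv.symm_apply_eq, b.starProjection_eq_sum_rankOne]
  ext1 v
  ext x
  simp [Matrix.toLpLin_apply, Matrix.vecMulVec_mulVec,
    EuclideanSpace.inner_eq_star_dotProduct, mul_comm, dotProduct_comm]

theorem entanglementOfFormation_le_of_forall_entropy_le (A : Finset V) {m : ℕ} {p : Fin m → ℝ}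
    {ψ : Fin m → StateSpace V} {s : ℝ} (hp : ∀ i, 0 ≤ p i) (hsum : ∑ i, p i = 1)
    (hψ : ∀ i, ‖ψ i‖ = 1) (hs : ∀ i, entanglementEntropy A (ψ i) ≤ s) :
    entanglementOfFormation A
      (∑ i, (p i : ℂ) • Matrix.vecMulVec (ψ i) (star (ψ i : (V → Fin 2) → ℂ))) ≤ s := by
  refine csInf_le_of_le ⟨0, ?_⟩ ⟨m, p, ψ, hp, hsum, hψ, rfl, rfl⟩ ?_
  · rintro E ⟨m, p, ψ, hp, -, hψ, -, rfl⟩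
    exact Finset.sum_nonneg fun i _ => mul_nonneg (hp i) (entanglementEntropy_nonneg A (hψ i))
  · calc ∑ i, p i * entanglementEntropy A (ψ i)
      _ ≤ ∑ i, p i * s := Finset.sum_le_sum fun i _ => mul_le_mul_of_nonneg_left (hs i) (hp i)
      _ = s := by rw [← Finset.sum_mul, hsum, one_mul]

theorem entanglementEntropy_le_of_mem_groundSpace (A : Finset V) {H : Hamiltonian V}
    (hN : H.IsNatural) (hU : H.IsUnfrustrated) {ψ : StateSpace V} (hψ : ψ ∈ H.groundSpace)
    (hnorm : ‖ψ‖ = 1) :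
    entanglementEntropy A ψ ≤ Real.logb 2 ((min A.card Aᶜ.card : ℕ) + 1) := by
  refine (entanglementEntropy_le_logb_rank A hnorm).trans ?_
  have hrank : ((coeffMatrix A ψ).rank : ℝ) ≤ (min A.card Aᶜ.card : ℕ) + 1 := by
    exact_mod_cast rank_coeffMatrix_le_of_mem_groundSpace A hN hU hψ
  rcases (coeffMatrix A ψ).rank.eq_zero_or_pos with hzero | hpos
  · rw [hzero, Nat.cast_zero, Real.logb_zero]
    exact Real.logb_nonneg one_lt_two (by simp)
  · exact Real.logb_le_logb_of_le one_lt_two (by exact_mod_cast hpos) hrank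

theorem entanglementOfFormation_groundState_le {H : Hamiltonian V} (hN : H.IsNatural)
    (hU : H.IsUnfrustrated) (A : Finset V) :
    entanglementOfFormation A H.groundState ≤ Real.logb 2 ((min A.card Aᶜ.card : ℕ) + 1) := by
  set D := Module.finrank ℂ H.groundSpace
  have hD : (D : ℝ) ≠ 0 := by
    have : Nontrivial H.groundSpace := Submodule.nontrivial_iff_ne_bot.2 H.groundSpace_ne_bot
    exact_mod_cast Module.finrank_pos.ne'
  have hnorm (i) : ‖(stdOrthonormalBasis ℂ H.groundSpace i : StateSpace V)‖ = 1 := by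
    rw [Submodule.norm_coe, OrthonormalBasis.norm_eq_one]
  convert entanglementOfFormation_le_of_forall_entropy_le A (p := fun _ : Fin D => (D : ℝ)⁻¹)
    (fun _ => by positivity) (by simp [hD]) hnorm
    (fun i => entanglementEntropy_le_of_mem_groundSpace A hN hU (Subtype.mem _) (hnorm i))
  simp only [H.groundState_eq_sum (stdOrthonormalBasis ℂ H.groundSpace), Complex.ofReal_inv,
    Complex.ofReal_natCast, D]

end Formation

section Isoperimetry

open scoped NNReal ENNReal

theorem edgeBoundary_compl {V : Type*} [Fintype V] [DecidableEq V] (G : SimpleGraph V)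
    (A : Finset V) : edgeBoundary G Aᶜ = edgeBoundary G A := by
  ext e
  simp only [edgeBoundary, Set.mem_ofPred_eq, Finset.mem_compl, not_not]
  constructor <;>
  · rintro ⟨a, ha, b, hb, hab, rfl⟩
    exact ⟨b, hb, a, ha, hab.symm, Sym2.eq_swap⟩

open scoped Classical in
/-- The inner vertex boundary of a region: its vertices that have a neighbor outside of it. -/
def innerBoundary {V : Type*} (G : SimpleGraph V) (A : Finset V) : Finset V :=
  {a ∈ A | ∃ b ∉ A, G.Adj a b}

theorem card_innerBoundary_le_boundaryArea {V : Type*} [Finite V] (G : SimpleGraph V)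
    (A : Finset V) : (innerBoundary G A).card ≤ boundaryArea G A := by
  have hout : ∀ a ∈ innerBoundary G A, a ∈ A ∧ ∃ b ∉ A, G.Adj a b := fun a ha => by
    simpa [innerBoundary] using ha
  choose! hmem out hout hadj using hout
  rw [← Set.ncard_coe_finset]
  refine Set.ncard_le_ncard_of_injOn (fun a => s(a, out a))
    (fun a ha => ⟨a, hmem a ha, out a, hout a ha, hadj a ha, rfl⟩) (fun a ha a' ha' h => ?_)
    (Set.toFinite _)
  rcases Sym2.eq_iff.1 h with ⟨rfl, -⟩ | ⟨rfl, -⟩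
  · rfl
  · exact absurd (hmem _ ha) (hout a' ha')

/-- A discrete form of the Loomis–Whitney inequality, from the Gagliardo–Nirenberg grid-lines
lemma. -/
theorem card_le_sum_rpow_of_one_le_sum_update {ι : Type*} [Fintype ι] [DecidableEq ι]
    {α : ι → Type*} [∀ i, Fintype (α i)] {p : ℝ} (hp : (Fintype.card ι : ℝ).HolderConjugate p)
    (S : Finset (∀ i, α i)) (f : (∀ i, α i) → ℝ≥0)
    (hf : ∀ x ∈ S, ∀ i, 1 ≤ ∑ t, f (Function.update x i t)) :
    (S.card : ℝ≥0) ≤ (∑ x, f x) ^ p := by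
  classical
  let _ : ∀ i, MeasurableSpace (α i) := fun _ => ⊤
  have gridLines := MeasureTheory.lintegral_prod_lintegral_pow_le
    (fun i => (MeasureTheory.Measure.count : MeasureTheory.Measure (α i))) hp
    (f := fun x => (f x : ℝ≥0∞)) (measurable_of_finite _)
  simp only [MeasureTheory.lintegral_fintype, MeasureTheory.Measure.pi_singleton,
    MeasureTheory.Measure.count_singleton, Finset.prod_const_one, mul_one] at gridLines
  rw [← ENNReal.coe_le_coe, ENNReal.coe_rpow_of_nonneg _ hp.symm.nonneg]
  push_cast
  refine le_trans ?_ gridLines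
  have hcard : (S.card : ℝ≥0∞) = ∑ x ∈ S, 1 := by simp
  rw [hcard]
  refine (Finset.sum_le_sum fun x hx => ?_).trans
    (Finset.sum_le_sum_of_subset (Finset.subset_univ S))
  refine Finset.one_le_prod'' fun i => ENNReal.one_le_rpow ?_ ?_
  · exact_mod_cast hf x hx i
  · exact one_div_pos.2 (sub_pos.2 hp.lt)

variable {d n : ℕ}

theorem cubicLattice_adj_update (z : Fin d → Fin n) (i : Fin d) {s t : Fin n}
    (h : (SimpleGraph.pathGraph n).Adj s t) :
    (cubicLattice d n).Adj (Function.update z i s) (Function.update z i t) := by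
  change ∑ j, Nat.dist _ _ = 1
  rw [Finset.sum_eq_single i (fun j _ hj => by simp [hj]) (by simp)]
  rw [SimpleGraph.pathGraph_adj] at h
  simp only [Function.update_self, Nat.dist]
  lia

theorem exists_update_mem_innerBoundary {A : Finset (Fin d → Fin n)} {z : Fin d → Fin n}
    (hz : z ∈ A) (i : Fin d) {t : Fin n} (ht : Function.update z i t ∉ A) :
    ∃ s, Function.update z i s ∈ innerBoundary (cubicLattice d n) A := by
  obtain ⟨p⟩ := SimpleGraph.pathGraph_preconnected n (z i) t
  obtain ⟨e, -, hin, hout⟩ :=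
    p.exists_boundary_dart {s | Function.update z i s ∈ A} (by simpa using hz) ht
  exact ⟨e.fst, by simpa [innerBoundary] using
    ⟨hin, _, hout, cubicLattice_adj_update z i e.adj⟩⟩
theorem one_le_sum_update_indicator_innerBoundary_add {A : Finset (Fin d → Fin n)}
    {z : Fin d → Fin n} (hz : z ∈ A) (i : Fin d) :
    1 ≤ ∑ t, ((innerBoundary (cubicLattice d n) A : Set (Fin d → Fin n)).indicator 1
        (Function.update z i t) +
      (A : Set (Fin d → Fin n)).indicator (fun _ => (n : ℝ≥0)⁻¹) (Function.update z i t)) := by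
  by_cases hline : ∀ t, Function.update z i t ∈ A
  · have hn : (n : ℝ≥0) ≠ 0 := Nat.cast_ne_zero.2 (z i).pos.ne'
    calc (1 : ℝ≥0) = ∑ _t : Fin n, (n : ℝ≥0)⁻¹ := by simp [hn]
      _ ≤ _ := Finset.sum_le_sum fun t _ => by simp [hline t]
  · push Not at hline
    obtain ⟨t, ht⟩ := hline
    obtain ⟨s, hs⟩ := exists_update_mem_innerBoundary hz i ht
    refine le_trans ?_ (Finset.single_le_sum (fun _ _ => zero_le) (Finset.mem_univ s))
    simp [hs]

theorem one_sub_one_div_pos (hd : 2 ≤ d) : (0 : ℝ) < 1 - 1 / d := by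
  have : (1 : ℝ) < d := by exact_mod_cast hd
  rw [sub_pos, div_lt_one] <;> linarith

theorem card_rpow_le_boundaryArea_add (hd : 2 ≤ d) (A : Finset (Fin d → Fin n)) :
    (A.card : ℝ) ^ (1 - 1 / d : ℝ) ≤ boundaryArea (cubicLattice d n) A + A.card / n := by
  have hp : (Fintype.card (Fin d) : ℝ).HolderConjugate (1 - 1 / d : ℝ)⁻¹ := by
    rw [Fintype.card_fin, Real.holderConjugate_iff]
    exact ⟨by exact_mod_cast hd, by rw [inv_inv]; ring⟩
  classical
  have hcard := card_le_sum_rpow_of_one_le_sum_update hp A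
    (fun z => (innerBoundary (cubicLattice d n) A : Set (Fin d → Fin n)).indicator 1 z +
      (A : Set (Fin d → Fin n)).indicator (fun _ => (n : ℝ≥0)⁻¹) z)
    fun z hz i => one_le_sum_update_indicator_innerBoundary_add hz i
  simp only [Finset.sum_add_distrib, Set.indicator_apply, Finset.mem_coe, Pi.one_apply,
    Finset.sum_ite_mem, Finset.univ_inter, Finset.sum_const, nsmul_eq_mul, mul_one] at hcard
  rw [NNReal.le_rpow_inv_iff (one_sub_one_div_pos hd), ← NNReal.coe_le_coe] at hcard
  push_cast at hcard
  have hinner : ((innerBoundary (cubicLattice d n) A).card : ℝ) ≤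
      boundaryArea (cubicLattice d n) A := by
    exact_mod_cast card_innerBoundary_le_boundaryArea _ A
  rw [div_eq_mul_inv (A.card : ℝ)]
  linarith

theorem div_le_half_rpow_mul_rpow (hd : d ≠ 0) {m l : ℝ} (hm : 0 < m) (hl : 0 < l)
    (h : 2 * m ≤ l ^ d) : m / l ≤ (1 / 2) ^ (1 / d : ℝ) * m ^ (1 - 1 / d : ℝ) := by
  have hroot : m ^ (1 / d : ℝ) ≤ (1 / 2) ^ (1 / d : ℝ) * l :=
    calc m ^ (1 / d : ℝ) ≤ (1 / 2 * l ^ d) ^ (1 / d : ℝ) := by gcongr; linarith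
      _ = (1 / 2) ^ (1 / d : ℝ) * l := by
        rw [Real.mul_rpow (by norm_num) (by positivity), one_div (d : ℝ),
          Real.pow_rpow_inv_natCast hl.le hd]
  rw [div_le_iff₀ hl]
  calc m = m ^ (1 / d : ℝ) * m ^ (1 - 1 / d : ℝ) := by
        rw [← Real.rpow_add hm, add_sub_cancel, Real.rpow_one]
    _ ≤ (1 / 2) ^ (1 / d : ℝ) * l * m ^ (1 - 1 / d : ℝ) := by gcongr
    _ = (1 / 2) ^ (1 / d : ℝ) * m ^ (1 - 1 / d : ℝ) * l := by ring

theorem mul_card_rpow_le_boundaryArea (hd : 2 ≤ d) {A : Finset (Fin d → Fin n)}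
    (hA : A.card ≤ Aᶜ.card) :
    (1 - (1 / 2) ^ (1 / d : ℝ)) * (A.card : ℝ) ^ (1 - 1 / d : ℝ) ≤
      boundaryArea (cubicLattice d n) A := by
  rcases A.eq_empty_or_nonempty with rfl | ⟨z, hz⟩
  · rw [Finset.card_empty, Nat.cast_zero, Real.zero_rpow (one_sub_one_div_pos hd).ne', mul_zero]
    exact Nat.cast_nonneg _
  have hn : (0 : ℝ) < n := by exact_mod_cast (z ⟨0, by lia⟩).pos
  have hm : (0 : ℝ) < A.card := by exact_mod_cast Finset.card_pos.2 ⟨z, hz⟩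
  have hhalf : 2 * (A.card : ℝ) ≤ (n : ℝ) ^ d := by
    have := A.card_add_card_compl
    rw [Fintype.card_pi_const, Fintype.card_fin] at this
    exact_mod_cast (by lia : 2 * A.card ≤ n ^ d)
  have hgrid := card_rpow_le_boundaryArea_add hd A
  have hdiv := div_le_half_rpow_mul_rpow (by lia : d ≠ 0) hm hn hhalf
  linarith

theorem mul_min_card_rpow_le_boundaryArea (hd : 2 ≤ d) (A : Finset (Fin d → Fin n)) :
    (1 - (1 / 2) ^ (1 / d : ℝ)) * ((min A.card Aᶜ.card : ℕ) : ℝ) ^ (1 - 1 / d : ℝ) ≤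
      boundaryArea (cubicLattice d n) A := by
  rcases le_total A.card Aᶜ.card with h | h
  · rw [min_eq_left h]
    exact mul_card_rpow_le_boundaryArea hd h
  · rw [min_eq_right h, boundaryArea, ← edgeBoundary_compl]
    exact mul_card_rpow_le_boundaryArea hd (by rwa [compl_compl])

end Isoperimetry

section LogarithmLaw

theorem logb_add_one_le_mul_logb {c K m t : ℝ} (hc : 0 < c) (hK : 0 < K) (hm : 0 ≤ m) (ht : 2 ≤ t)
    (h : K * m ^ c ≤ t) :
    Real.logb 2 (m + 1) ≤ (Real.logb 2 (1 + K⁻¹ ^ c⁻¹) + c⁻¹) * Real.logb 2 t := by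
  have hroot : m ≤ K⁻¹ ^ c⁻¹ * t ^ c⁻¹ := by
    rw [← Real.mul_rpow (by positivity) (by positivity),
      Real.le_rpow_inv_iff_of_pos hm (by positivity) hc, le_inv_mul_iff₀ hK]
    exact h
  have hpow : 1 ≤ t ^ c⁻¹ := Real.one_le_rpow (by linarith) (by positivity)
  have hlog : 1 ≤ Real.logb 2 t := by
    rwa [Real.le_logb_iff_rpow_le one_lt_two (by positivity), Real.rpow_one]
  have hconst : 0 ≤ Real.logb 2 (1 + K⁻¹ ^ c⁻¹) :=
    Real.logb_nonneg one_lt_two (le_add_of_nonneg_right (by positivity))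
  calc Real.logb 2 (m + 1) ≤ Real.logb 2 ((1 + K⁻¹ ^ c⁻¹) * t ^ c⁻¹) :=
        Real.logb_le_logb_of_le one_lt_two (by positivity) (by linarith)
    _ = Real.logb 2 (1 + K⁻¹ ^ c⁻¹) + c⁻¹ * Real.logb 2 t := by
        rw [Real.logb_mul (by positivity) (by positivity),
          Real.logb_rpow_eq_mul_logb_of_pos (by positivity)]
    _ ≤ (Real.logb 2 (1 + K⁻¹ ^ c⁻¹) + c⁻¹) * Real.logb 2 t := by
        rw [add_mul]
        gcongr
        exact le_mul_of_one_le_right hconst hlog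

theorem exists_logb_add_one_le_of_mul_rpow_le {c K : ℝ} (hc : 0 < c) (hK : 0 < K) :
    ∃ C : ℝ, 0 < C ∧ ∀ m b : ℕ, K * (m : ℝ) ^ c ≤ b →
      (2 ≤ b → Real.logb 2 (m + 1) ≤ C * Real.logb 2 b) ∧
      Real.logb 2 (m + 1) ≤ C * Real.logb 2 (b + 1) := by
  have hconst : 0 ≤ Real.logb 2 (1 + K⁻¹ ^ c⁻¹) :=
    Real.logb_nonneg one_lt_two (le_add_of_nonneg_right (by positivity))
  refine ⟨Real.logb 2 (1 + K⁻¹ ^ c⁻¹) + c⁻¹, by positivity, fun m b h => ⟨fun hb => ?_, ?_⟩⟩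
  · exact logb_add_one_le_mul_logb hc hK m.cast_nonneg (by exact_mod_cast hb) h
  · rcases b.eq_zero_or_pos with rfl | hb
    · have hm : m = 0 := by
        by_contra hm
        have : 0 < K * (m : ℝ) ^ c := by positivity
        exact this.not_ge (by exact_mod_cast h)
      simp [hm]
    · have htwo : (2 : ℝ) ≤ b + 1 := by exact_mod_cast Nat.succ_le_succ hb
      exact logb_add_one_le_mul_logb hc hK m.cast_nonneg htwo (h.trans (by linarith))

end LogarithmLaw

end SpinLattice

end

theorem mainTheorem2_general :
    (∀ c K : ℝ, 0 < c → 0 < K → ∃ C : ℝ, 0 < C ∧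
      ∀ (V : Type*) [Fintype V] [DecidableEq V] (H : SpinLattice.Hamiltonian V),
        H.IsNatural → H.IsUnfrustrated →
        ∀ A : Finset V,
          K * ((min A.card Aᶜ.card : ℕ) : ℝ) ^ c ≤
            SpinLattice.boundaryArea H.interactionGraph A →
          (2 ≤ SpinLattice.boundaryArea H.interactionGraph A →
            SpinLattice.entanglementOfFormation A H.groundState ≤
              C * Real.logb 2 (SpinLattice.boundaryArea H.interactionGraph A)) ∧
          SpinLattice.entanglementOfFormation A H.groundState ≤
            C * Real.logb 2 (SpinLattice.boundaryArea H.interactionGraph A + 1)) ∧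
    (∀ d : ℕ, 2 ≤ d → ∃ C : ℝ, 0 < C ∧
      ∀ (n : ℕ) (H : SpinLattice.Hamiltonian (Fin d → Fin n)),
        H.interactionGraph = SpinLattice.cubicLattice d n →
        H.IsNatural → H.IsUnfrustrated →
        ∀ A : Finset (Fin d → Fin n),
          (2 ≤ SpinLattice.boundaryArea H.interactionGraph A →
            SpinLattice.entanglementOfFormation A H.groundState ≤
              C * Real.logb 2 (SpinLattice.boundaryArea H.interactionGraph A)) ∧
          SpinLattice.entanglementOfFormation A H.groundState ≤
            C * Real.logb 2 (SpinLattice.boundaryArea H.interactionGraph A + 1)) := by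
  refine ⟨fun c K hc hK => ?_, fun d hd => ?_⟩
  · obtain ⟨C, hC, hlog⟩ := SpinLattice.exists_logb_add_one_le_of_mul_rpow_le hc hK
    refine ⟨C, hC, fun V _ _ H hN hU A hA => ?_⟩
    have hE := SpinLattice.entanglementOfFormation_groundState_le hN hU A
    exact (hlog _ _ hA).imp (fun h hb => hE.trans (h hb)) hE.trans
  · have hK : (0 : ℝ) < 1 - (1 / 2) ^ (1 / d : ℝ) :=
      sub_pos.2 (Real.rpow_lt_one (by norm_num) (by norm_num) (by positivity))
    obtain ⟨C, hC, hlog⟩ := SpinLattice.exists_logb_add_one_le_of_mul_rpow_le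
      (SpinLattice.one_sub_one_div_pos hd) hK
    refine ⟨C, hC, fun n H hH hN hU A => ?_⟩
    have hE := SpinLattice.entanglementOfFormation_groundState_le hN hU A
    have hgrowth := SpinLattice.mul_min_card_rpow_le_boundaryArea hd A
    rw [← hH] at hgrowth
    exact (hlog _ _ hgrowth).imp (fun h hb => hE.trans (h hb)) hE.trans

theorem mainTheorem2 :
    (∀ c K : ℝ, 0 < c → 0 < K → ∃ C : ℝ, 0 < C ∧
      ∀ (V : Type*) [Fintype V] [DecidableEq V] (H : SpinLattice.Hamiltonian V),
        SpinLattice.HasBoundaryGrowth H.interactionGraph c K →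
        H.IsNatural → H.IsUnfrustrated →
        ∀ A : Finset V, SpinLattice.IsContiguous H.interactionGraph A →
          (2 ≤ SpinLattice.boundaryArea H.interactionGraph A →
            SpinLattice.entanglementOfFormation A H.groundState ≤
              C * Real.logb 2 (SpinLattice.boundaryArea H.interactionGraph A)) ∧
          SpinLattice.entanglementOfFormation A H.groundState ≤
            C * Real.logb 2 (SpinLattice.boundaryArea H.interactionGraph A + 1)) ∧
    (∀ d : ℕ, 2 ≤ d → ∃ C : ℝ, 0 < C ∧
      ∀ (n : ℕ) (H : SpinLattice.Hamiltonian (Fin d → Fin n)),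
        H.interactionGraph = SpinLattice.cubicLattice d n →
        H.IsNatural → H.IsUnfrustrated →
        ∀ A : Finset (Fin d → Fin n), SpinLattice.IsContiguous H.interactionGraph A →
          (2 ≤ SpinLattice.boundaryArea H.interactionGraph A →
            SpinLattice.entanglementOfFormation A H.groundState ≤
              C * Real.logb 2 (SpinLattice.boundaryArea H.interactionGraph A)) ∧
          SpinLattice.entanglementOfFormation A H.groundState ≤
            C * Real.logb 2 (SpinLattice.boundaryArea H.interactionGraph A + 1)) := by
  refine ⟨fun c K hc hK => ?_, fun d hd => ?_⟩
  · obtain ⟨C, hC, hE⟩ := mainTheorem2_general.1 c K hc hK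
    exact ⟨C, hC, fun V _ _ H hG hN hU A hA => hE V H hN hU A (hG A hA)⟩
  · obtain ⟨C, hC, hE⟩ := mainTheorem2_general.{0}.2 d hd
    exact ⟨C, hC, fun n H hH hN hU A _ => hE n H hH hN hU A⟩
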